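/- Let $k$ be a field of characteristic zero, $K=k(t)$ the field of rational functions over $k$, and fix an algebraic closure $\overline{K}$ of $K$. For a polynomial $\phi\in k[t][x]$ write $\phi^n$ for its $n$-th iterate in $x$ (with $\phi^0=x$). Let $T_n(\phi)\subset\overline{K}$ be the set consisting of $0$ and the roots of $\phi,\phi^2,\dots,\phi^n$, put $T_\infty(\phi)=\bigcup_{n\ge 0}T_n(\phi)$, and regard $T_\infty(\phi)$ as a graph with root $0$ in which two distinct vertices $\alpha,\beta$ share an edge if and only if $\phi(\alpha)=\beta$ or $\phi(\beta)=\alpha$. Let $\operatorname{Aut}(T_\infty(\phi))$ be the group of graph automorphisms of $T_\infty(\phi)$ fixing the root. Let $K_n=K(T_n(\phi))$, $G_n(\phi)=\operatorname{Gal}(K_n/K)$ and $G_\infty(\phi)=\varprojlim G_n(\phi)$, the inverse limit along the restriction maps; $G_\infty(\phi)$ acts on $T_\infty(\phi)$ by root-preserving graph automorphisms. Let $d\ge 1$ be an integer, let $m\in k$, and let $\phi(x)=(x-t^d)^2+(t^d+m)\in k[t][x]$. If the critical orbit $\{\phi^n(t^d):n\ge 1\}\subset k[t]$ is infinite, then the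 arboreal representation $G_\infty(\phi)\to\operatorname{Aut}(T_\infty(\phi))$ given by this action is an isomorphism of groups. In particular, if $k=\mathbb{Q}$, then for every $d\ge 1$ and every $m\in\mathbb{Q}\setminus\{0,-1,-2\}$ the map $G_\infty(\phi)\to\operatorname{Aut}(T_\infty(\phi))$ is an isomorphism. -/

import Mathlib

open Polynomial

noncomputable section

namespace Arboreal

universe u v

/-- The (forward) orbit `{φ(a), φ²(a), φ³(a), …}` of `a` under the polynomial map `φ`. -/
def forwardOrbit {R : Type u} [CommRing R] (φ : R[X]) (a : R) : Set R :=
  {b | ∃ n : ℕ, 1 ≤ n ∧ b = (fun x => φ.eval x)^[n] a}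

variable {K : Type u} [Field K] (L : Type v) [Field L] [Algebra K L]

/-- The `n`-th iterate `φⁿ` (composition) as a polynomial; `φ⁰` is `X`. -/
def iter (φ : K[X]) (n : ℕ) : K[X] := (φ.comp)^[n] X

/-- `T_n(φ)`: the roots, in an algebraic closure `L` of `K`, of `φ, φ², …, φⁿ`, together with `0`,
which is the root of `φ⁰ = X`. -/
def treeLevel (φ : K[X]) (n : ℕ) : Set L :=
  {α | ∃ i ≤ n, aeval α (iter φ i) = 0}

/-- `T_∞(φ) = ⋃ T_n(φ)`. -/
def treeSet (φ : K[X]) : Set L := ⋃ n, treeLevel L φ n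

/-- The root `0` of the tree. -/
def root (φ : K[X]) : treeSet L φ :=
  ⟨0, Set.mem_iUnion.2 ⟨0, 0, le_rfl, by simp [iter]⟩⟩

/-- The graph on `T_∞(φ)`: two distinct vertices `α`, `β` share an edge if and only if
`φ(α) = β` or `φ(β) = α`. -/
def tree (φ : K[X]) : SimpleGraph (treeSet L φ) :=
  SimpleGraph.fromRel fun α β => aeval (α : L) φ = (β : L)

/-- `Aut(T_∞(φ))`: automorphisms of `T_∞(φ)` as a rooted tree. -/
def treeAut (φ : K[X]) : Subgroup (tree L φ ≃g tree L φ) where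
  carrier := {f | f (root L φ) = root L φ}
  one_mem' := rfl
  mul_mem' := fun {f g} (hf : f (root L φ) = root L φ) (hg : g (root L φ) = root L φ) =>
    show f (g (root L φ)) = root L φ by rw [hg, hf]
  inv_mem' := fun {f} (hf : f (root L φ) = root L φ) =>
    show f.symm (root L φ) = root L φ by rw [RelIso.symm_apply_eq, hf]

/-- `K_n = K(T_n(φ))`. -/
def levelField (φ : K[X]) (n : ℕ) : IntermediateField K L :=
  IntermediateField.adjoin K (treeLevel L φ n)

/-- `G_n(φ) = Gal(K_n / K)`. -/
abbrev levelGroup (φ : K[X]) (n : ℕ) : Type v := levelField L φ n ≃ₐ[K] levelField L φ n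

variable {L}

theorem mem_levelField {φ : K[X]} {n : ℕ} {α : L} (h : α ∈ treeLevel L φ n) :
    α ∈ levelField L φ n :=
  IntermediateField.subset_adjoin K _ h

variable (L)

theorem treeLevel_mono (φ : K[X]) {m n : ℕ} (h : m ≤ n) : treeLevel L φ m ⊆ treeLevel L φ n :=
  fun _ ⟨i, hi, h0⟩ => ⟨i, hi.trans h, h0⟩

theorem levelField_mono (φ : K[X]) {m n : ℕ} (h : m ≤ n) : levelField L φ m ≤ levelField L φ n :=
  IntermediateField.adjoin.mono K _ _ (treeLevel_mono L φ h)

/-- `G_∞(φ)`: the inverse limit of the groups `G_n(φ)` along restriction, i.e. the sequences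
`(σ_n)` in `∏ G_n(φ)` such that `σ_n` restricts to `σ_m` on `K_m` whenever `m ≤ n`. -/
def limitGroup (φ : K[X]) : Subgroup (∀ n, levelGroup L φ n) where
  carrier := {σ | ∀ (m n : ℕ) (h : m ≤ n) (x : L) (hx : x ∈ levelField L φ m),
    (σ n ⟨x, levelField_mono L φ h hx⟩ : L) = σ m ⟨x, hx⟩}
  one_mem' := fun _ _ _ _ _ => by simp only [Pi.one_apply, AlgEquiv.one_apply]
  mul_mem' := fun {σ τ} hσ hτ m n h x hx => by
    change (σ n (τ n _) : L) = σ m (τ m _)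
    have h1 := hσ m n h _ (τ m ⟨x, hx⟩).2
    rw [← h1]
    exact congrArg (fun y => (σ n y : L)) (Subtype.ext (hτ m n h x hx))
  inv_mem' := fun {σ} hσ m n h x hx => by
    change ((σ n).symm _ : L) = ((σ m).symm _ : levelField L φ m)
    have h1 := hσ m n h _ ((σ m).symm ⟨x, hx⟩).2
    have h2 : (σ n).symm ⟨x, levelField_mono L φ h hx⟩ =
        ⟨((σ m).symm ⟨x, hx⟩ : levelField L φ m),
          levelField_mono L φ h ((σ m).symm ⟨x, hx⟩).2⟩ := by
      rw [AlgEquiv.symm_apply_eq]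
      apply Subtype.ext
      rw [h1, Subtype.coe_eta, AlgEquiv.apply_symm_apply]
    rw [h2]

variable {L}

theorem coe_aeval {φ : K[X]} {n : ℕ} (x : levelField L φ n) (p : K[X]) :
    aeval (x : L) p = (aeval x p : levelField L φ n) :=
  aeval_algHom_apply (levelField L φ n).val x p

theorem aeval_act {φ : K[X]} {n : ℕ} (g : levelGroup L φ n) (x : levelField L φ n) (p : K[X]) :
    aeval (g x : L) p = (g (aeval x p) : L) := by
  rw [coe_aeval, aeval_algHom_apply g]

theorem act_mem {φ : K[X]} {n : ℕ} (g : levelGroup L φ n) {α : L}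
    (h : α ∈ treeLevel L φ n) :
    (g ⟨α, mem_levelField h⟩ : L) ∈ treeLevel L φ n := by
  obtain ⟨i, hi, h0⟩ := h
  refine ⟨i, hi, ?_⟩
  have h1 : aeval (⟨α, mem_levelField ⟨i, hi, h0⟩⟩ : levelField L φ n) (iter φ i) = 0 := by
    apply Subtype.ext
    rw [← coe_aeval]
    exact h0
  rw [aeval_act, h1, map_zero]
  rfl

theorem exists_level {φ : K[X]} (α : treeSet L φ) : ∃ n, (α : L) ∈ treeLevel L φ n :=
  Set.mem_iUnion.1 α.2

/-- The action of `σ = (σ_n)` on a vertex `α`: it is `σ_n(α)` for some `n` with `α ∈ T_n(φ)`;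
by `act_eq` below, any such `n` gives the same value. -/
def act {φ : K[X]} (σ : limitGroup L φ) (α : treeSet L φ) : treeSet L φ :=
  ⟨σ.1 (exists_level α).choose ⟨α, mem_levelField (exists_level α).choose_spec⟩,
    Set.mem_iUnion.2 ⟨_, act_mem _ (exists_level α).choose_spec⟩⟩

theorem limit_coe_eq {φ : K[X]} (σ : limitGroup L φ) {m n : ℕ} {α : L}
    (hm : α ∈ levelField L φ m) (hn : α ∈ levelField L φ n) :
    (σ.1 m ⟨α, hm⟩ : L) = σ.1 n ⟨α, hn⟩ := by
  rcases le_total m n with h | h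
  · exact (σ.2 m n h α hm).symm
  · exact σ.2 n m h α hn

theorem act_eq {φ : K[X]} (σ : limitGroup L φ) (α : treeSet L φ) {n : ℕ}
    (h : (α : L) ∈ levelField L φ n) :
    (act σ α : L) = σ.1 n ⟨α, h⟩ :=
  limit_coe_eq σ _ h

theorem act_one {φ : K[X]} (α : treeSet L φ) : act (1 : limitGroup L φ) α = α := rfl

theorem act_mul {φ : K[X]} (σ τ : limitGroup L φ) (α : treeSet L φ) :
    act (σ * τ) α = act σ (act τ α) := by
  apply Subtype.ext
  obtain ⟨n, hn⟩ := exists_level α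
  have h := mem_levelField hn
  have h2 : (act τ α : L) ∈ levelField L φ n := by
    rw [act_eq τ α h]; exact (τ.1 n ⟨α, h⟩).2
  rw [act_eq _ α h, act_eq σ _ h2]
  have h3 : (⟨act τ α, h2⟩ : levelField L φ n) = τ.1 n ⟨α, h⟩ := Subtype.ext (act_eq τ α h)
  rw [h3]
  rfl

theorem act_rel {φ : K[X]} (σ : limitGroup L φ) {α β : treeSet L φ}
    (h : aeval (α : L) φ = (β : L)) :
    aeval (act σ α : L) φ = (act σ β : L) := by
  obtain ⟨n, hn⟩ := exists_level α
  have ha := mem_levelField hn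
  have hx : ((aeval (⟨α, ha⟩ : levelField L φ n) φ : levelField L φ n) : L) = β := by
    rw [← coe_aeval]; exact h
  have hb : (β : L) ∈ levelField L φ n := hx ▸ Subtype.property _
  rw [act_eq σ α ha, act_eq σ β hb, aeval_act]
  exact congrArg (fun y => ((σ.1 n y : levelField L φ n) : L)) (Subtype.ext hx)

theorem act_inv_act {φ : K[X]} (σ : limitGroup L φ) (α : treeSet L φ) : act σ⁻¹ (act σ α) = α := by
  rw [← act_mul, inv_mul_cancel, act_one]

theorem act_act_inv {φ : K[X]} (σ : limitGroup L φ) (α : treeSet L φ) : act σ (act σ⁻¹ α) = α := by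
  rw [← act_mul, mul_inv_cancel, act_one]

theorem act_adj {φ : K[X]} (σ : limitGroup L φ) {α β : treeSet L φ} (h : (tree L φ).Adj α β) :
    (tree L φ).Adj (act σ α) (act σ β) := by
  rw [tree, SimpleGraph.fromRel_adj] at h ⊢
  refine ⟨fun he => h.1 ?_, h.2.imp (act_rel σ) (act_rel σ)⟩
  rw [← act_inv_act σ α, he, act_inv_act]

/-- The automorphism of the graph `T_∞(φ)` given by `σ`. -/
def actIso {φ : K[X]} (σ : limitGroup L φ) : tree L φ ≃g tree L φ where
  toFun := act σ
  invFun := act σ⁻¹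
  left_inv := act_inv_act σ
  right_inv := act_act_inv σ
  map_rel_iff' := fun {α β} =>
    ⟨fun h => by simpa only [Equiv.coe_fn_mk, act_inv_act] using act_adj σ⁻¹ h, act_adj σ⟩

theorem act_root {φ : K[X]} (σ : limitGroup L φ) : act σ (root L φ) = root L φ := by
  apply Subtype.ext
  rw [act_eq σ (root L φ) (n := 0) (zero_mem _)]
  exact congrArg Subtype.val (map_zero (σ.1 0))

variable (L)

/-- The arboreal representation `G_∞(φ) → Aut(T_∞(φ))`. -/
def arborealRep (φ : K[X]) : limitGroup L φ →* treeAut L φ where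
  toFun := fun σ => ⟨actIso σ, act_root σ⟩
  map_one' := rfl
  map_mul' := fun σ τ => Subtype.ext (RelIso.ext (act_mul σ τ))

/-- The polynomial `(x - t ^ d) ^ 2 + (t ^ d + m)` in `k[t][x]`. -/
def family {k : Type u} [Field k] (d : ℕ) (m : k) : k[X][X] :=
  (X - C (X ^ d)) ^ 2 + C (X ^ d + C m)

/-- A polynomial in `k[t][x]`, viewed as a polynomial in `x` over the field `k(t)`. -/
def overRatFunc {k : Type u} [Field k] (φ : k[X][X]) : (RatFunc k)[X] :=
  φ.map (algebraMap k[X] (RatFunc k))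

end Arboreal

end

/-!
Put `γ = t ^ d` and `e = φ(γ) = t ^ d + m`, so that `φ(x) = (x - γ) ^ 2 + e`. The children of a
vertex `α` are `γ ± √(α - e)`, so the field `K_{n+1}` arises from `K_n` by adjoining the square
roots of the elements `α - e`, for `α` on level `n`. If these elements are independent modulo
squares in `K_n`, Kummer theory realises every choice of signs by an automorphism over `K_n`
(`exists_algEquiv_flip`), and every automorphism of the tree can be lifted level by level
(`exists_algEquiv_eq_on_level`). Compatibility with the inverse limit is automatic, because an
element of `Gal(K_n / K)` is determined by its values on the tree.

The independence on level `n` is proved by induction, with two companions: the Galois group is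
transitive on level `n`, and an element of `K` that is a square in `K_n` is, up to sign and
squares of `K`, a product of some of `φ(γ), …, φⁿ(γ)` (`LevelDescent`). The sets `S` of vertices
for which `∏_{α ∈ S} (α - e)` is a square form an `𝔽₂`-vector space on which the Galois group acts
through a `2`-group; were it nonzero, it would have a nonzero fixed vector, which by transitivity
is the full level. But the product over the full level is `± φⁿ⁺¹(γ)`, which by descent is not a
square in `K_n` as soon as the elements `φʲ(γ)` are independent modulo squares and signs in `K`
(`LevelIndep.of_transitive`). The descent passes to level `n + 1` because, again by Kummer theory,
an element of `K` that is a square in `K_{n+1}` becomes a square in `K_n` after multiplication by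
a product over some set `S`, which by independence is Galois stable, hence empty or the full
level.

For the family, `φʲ(γ) = t ^ d + a_j` with `a_j` the orbit of `0` under `y ↦ y ^ 2 + m`. If this
orbit is infinite, the `a_j` are distinct and nonzero, and the polynomials `t ^ d + a_j` are
separable and pairwise coprime (`criticalIndep_family`). Over `ℚ` the orbit is infinite for `m ≠
0, -1, -2` because it escapes at some place (`infinite_orbit_rat`).
-/

/-! ### Square roots of independent elements -/

section Kummer

variable {K L : Type*} [Field K] [Field L] [Algebra K L]

/-- If `r ^ 2` lies in `K(A)`, then `K(A, r)` consists of the elements `a + b * r`. -/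
theorem exists_add_mul_of_mem_adjoin_insert [Algebra.IsAlgebraic K L] {A : Set L} {r y : L}
    (hr : r ^ 2 ∈ IntermediateField.adjoin K A)
    (hy : y ∈ IntermediateField.adjoin K (insert r A)) :
    ∃ a ∈ IntermediateField.adjoin K A, ∃ b ∈ IntermediateField.adjoin K A, y = a + b * r := by
  have hy' : y ∈ Algebra.adjoin K (insert r A) := by
    rw [← IntermediateField.adjoin_toSubalgebra_of_isAlgebraic
      (fun x _ => Algebra.IsAlgebraic.isAlgebraic x)]
    exact hy
  clear hy
  induction hy' using Algebra.adjoin_induction with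
  | mem x hx =>
    rcases hx with rfl | hx
    · exact ⟨0, zero_mem _, 1, one_mem _, by ring⟩
    · exact ⟨x, IntermediateField.subset_adjoin K A hx, 0, zero_mem _, by ring⟩
  | algebraMap x => exact ⟨_, algebraMap_mem _ x, 0, zero_mem _, by ring⟩
  | add x y _ _ hx hy =>
    obtain ⟨a, ha, b, hb, rfl⟩ := hx
    obtain ⟨a', ha', b', hb', rfl⟩ := hy
    exact ⟨a + a', add_mem ha ha', b + b', add_mem hb hb', by ring⟩
  | mul x y _ _ hx hy =>
    obtain ⟨a, ha, b, hb, rfl⟩ := hx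
    obtain ⟨a', ha', b', hb', rfl⟩ := hy
    exact ⟨a * a' + b * b' * r ^ 2, add_mem (mul_mem ha ha') (mul_mem (mul_mem hb hb') hr),
      a * b' + a' * b, add_mem (mul_mem ha hb') (mul_mem ha' hb), by ring⟩

/-- The part of Kummer theory used here: an element of `F = K(A)` that becomes a square in
`F(√δ_i : i ∈ I)` is a square in `F` up to a product of some of the `δ_i = r_i ^ 2`. -/
theorem exists_mul_prod_eq_sq [Algebra.IsAlgebraic K L] [CharZero K] {A : Set L}
    {ι : Type*} (r : ι → L) (I : Finset ι)
    (hr : ∀ i ∈ I, r i ^ 2 ∈ IntermediateField.adjoin K A) {x y : L}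
    (hx : x ∈ IntermediateField.adjoin K A)
    (hy : y ∈ IntermediateField.adjoin K (A ∪ r '' I)) (hxy : y ^ 2 = x) :
    ∃ S ⊆ I, ∃ z ∈ IntermediateField.adjoin K A, x * ∏ i ∈ S, r i ^ 2 = z ^ 2 := by
  classical
  induction I using Finset.induction_on generalizing x y with
  | empty =>
    refine ⟨∅, subset_rfl, y, ?_, by simp [hxy]⟩
    simpa using hy
  | insert j I hj ih =>
    have hr' : ∀ i ∈ I, r i ^ 2 ∈ IntermediateField.adjoin K A :=
      fun i hi => hr i (Finset.mem_insert_of_mem hi)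
    have hle : IntermediateField.adjoin K A ≤ IntermediateField.adjoin K (A ∪ r '' I) :=
      IntermediateField.adjoin.mono K _ _ Set.subset_union_left
    have hjA := hr j (Finset.mem_insert_self j I)
    rw [Finset.coe_insert, Set.image_insert_eq, Set.union_insert] at hy
    obtain ⟨a, ha, b, hb, hab⟩ := exists_add_mul_of_mem_adjoin_insert (hle hjA) hy
    by_cases hyI : y ∈ IntermediateField.adjoin K (A ∪ r '' I)
    · obtain ⟨S, hS, z, hz, h⟩ := ih hr' hx hyI hxy
      exact ⟨S, hS.trans (Finset.subset_insert _ _), z, hz, h⟩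
    -- `y ^ 2 = a ^ 2 + b ^ 2 * r_j ^ 2 + 2 * a * b * r_j` lies in the smaller field, but `r_j`
    -- does not, so `a * b = 0`; and `b = 0` is excluded.
    have hb0 : b ≠ 0 := by
      rintro rfl
      exact hyI (by simpa [hab] using ha)
    have ha0 : a = 0 := by
      by_contra ha0
      have : CharZero L := charZero_of_injective_algebraMap (algebraMap K L).injective
      have h2 : (2 : L) * a * b ≠ 0 := by simp [ha0, hb0]
      have h2m : (2 : L) * a * b ∈ IntermediateField.adjoin K (A ∪ r '' I) :=
        mul_mem (mul_mem (ofNat_mem _ 2) ha) hb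
      have hrj : r j = (x - a ^ 2 - b ^ 2 * r j ^ 2) / (2 * a * b) := by
        rw [eq_div_iff h2, ← hxy, hab]
        ring
      have : r j ∈ IntermediateField.adjoin K (A ∪ r '' I) := by
        rw [hrj]
        exact div_mem (sub_mem (sub_mem (hle hx) (pow_mem ha 2))
          (mul_mem (pow_mem hb 2) (hle hjA))) h2m
      exact hyI (hab ▸ add_mem ha (mul_mem hb this))
    obtain ⟨S, hS, z, hz, h⟩ := ih hr' (mul_mem hx hjA) (mul_mem hb (hle hjA))
      (by rw [← hxy, hab, ha0]; ring)
    refine ⟨insert j S, Finset.insert_subset_insert _ hS, z, hz, ?_⟩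
    rw [Finset.prod_insert (fun hjS => hj (hS hjS)), ← mul_assoc, h]

/-- If the `δ_i = r_i ^ 2` are independent modulo squares in `K(A)`, then every choice of signs of
the `r_i` is realised by an automorphism over `K(A)`. -/
theorem exists_algEquiv_flip [IsGalois K L] [CharZero K] {A : Set L}
    {ι : Type*} (r : ι → L) (I : Finset ι)
    (hr : ∀ i ∈ I, r i ^ 2 ∈ IntermediateField.adjoin K A)
    (hind : ∀ S ⊆ I, ∀ z ∈ IntermediateField.adjoin K A, ∏ i ∈ S, r i ^ 2 = z ^ 2 → S = ∅)
    (T : Set ι) :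
    ∃ σ : L ≃ₐ[K] L, (∀ x ∈ IntermediateField.adjoin K A, σ x = x) ∧
      ∀ i ∈ I, (i ∈ T → σ (r i) = -r i) ∧ (i ∉ T → σ (r i) = r i) := by
  classical
  induction I using Finset.induction_on with
  | empty => exact ⟨1, by simp, by simp⟩
  | insert j I hj ih =>
    have hr' : ∀ i ∈ I, r i ^ 2 ∈ IntermediateField.adjoin K A :=
      fun i hi => hr i (Finset.mem_insert_of_mem hi)
    have hle : IntermediateField.adjoin K A ≤ IntermediateField.adjoin K (A ∪ r '' I) :=
      IntermediateField.adjoin.mono K _ _ Set.subset_union_left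
    have hjA := hr j (Finset.mem_insert_self j I)
    obtain ⟨σ, hσA, hσ⟩ := ih hr' (fun S hS => hind S (hS.trans (Finset.subset_insert _ _)))
    have hnot : r j ∉ IntermediateField.adjoin K (A ∪ r '' I) := by
      intro hmem
      obtain ⟨S, hS, z, hz, h⟩ := exists_mul_prod_eq_sq r I hr' hjA hmem rfl
      rw [← Finset.prod_insert (f := fun i => r i ^ 2) (fun hjS => hj (hS hjS))] at h
      exact Finset.insert_ne_empty j S (hind _ (Finset.insert_subset_insert _ hS) z hz h)
    obtain ⟨τ, hτ, hτj⟩ : ∃ τ : L ≃ₐ[K] L,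
        (∀ x ∈ IntermediateField.adjoin K (A ∪ r '' I), τ x = x) ∧ τ (r j) ≠ r j := by
      by_contra! hcon
      apply hnot
      rw [← InfiniteGalois.fixedField_fixingSubgroup (IntermediateField.adjoin K (A ∪ r '' I)),
        IntermediateField.mem_fixedField_iff]
      intro τ hτ
      exact hcon τ ((IntermediateField.mem_fixingSubgroup_iff _ _).1 hτ)
    have hsgn : ∀ ρ : L ≃ₐ[K] L, (∀ x ∈ IntermediateField.adjoin K A, ρ x = x) →
        ρ (r j) = r j ∨ ρ (r j) = -r j := fun ρ hρ => by
      rw [← sq_eq_sq_iff_eq_or_eq_neg, ← map_pow, hρ _ hjA]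
    have hτj' : τ (r j) = -r j := (hsgn τ fun x hx => hτ x (hle hx)).resolve_left hτj
    have hτI : ∀ i ∈ I, τ (r i) = r i := fun i hi =>
      hτ _ (IntermediateField.subset_adjoin K _ (Or.inr ⟨i, hi, rfl⟩))
    have hστ : (∀ x ∈ IntermediateField.adjoin K A, (σ * τ) x = x) ∧
        ∀ i ∈ I, (σ * τ) (r i) = σ (r i) :=
      ⟨fun x hx => by rw [AlgEquiv.mul_apply, hτ x (hle hx), hσA x hx],
        fun i hi => by rw [AlgEquiv.mul_apply, hτI i hi]⟩
    have hmul : (σ * τ) (r j) = -σ (r j) := by rw [AlgEquiv.mul_apply, hτj', map_neg]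
    -- One of `σ`, `σ * τ` has the required sign at `r_j`.
    by_cases hgood : (j ∈ T → σ (r j) = -r j) ∧ (j ∉ T → σ (r j) = r j)
    · exact ⟨σ, hσA, Finset.forall_mem_insert _ _ _ |>.2 ⟨hgood, hσ⟩⟩
    · refine ⟨σ * τ, hστ.1, Finset.forall_mem_insert _ _ _ |>.2 ⟨?_, fun i hi => ?_⟩⟩
      · rcases hsgn σ hσA with h | h <;> by_cases hT : j ∈ T <;> simp_all
      · rw [hστ.2 i hi]
        exact hσ i hi

end Kummer

/-! ### Symmetric sets under a `2`-group -/

/-- Let `V` be a family of subsets of a finite set on which a `2`-group acts transitively. If `V` is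
stable under the group and under symmetric differences, and has a nonempty member, then it contains
the full set: a `2`-group acting on a nonzero finite `𝔽₂`-vector space has a nonzero fixed
vector. -/
theorem univ_of_symmDiff_closed {H Λ : Type*} [Group H] [Fintype Λ] [DecidableEq Λ] [MulAction H Λ]
    [MulAction.IsPretransitive H Λ] (hH : IsPGroup 2 H) (V : Set (Finset Λ)) (h0 : ∅ ∈ V)
    (hsymm : ∀ S ∈ V, ∀ T ∈ V, symmDiff S T ∈ V)
    (hact : ∀ g : H, ∀ S ∈ V, S.image (g • ·) ∈ V)
    {S : Finset Λ} (hS : S ∈ V) (hne : S ≠ ∅) : Finset.univ ∈ V := by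
  classical
  let act : MulAction H V :=
    { smul := fun g S => ⟨S.1.image (g • ·), hact g S.1 S.2⟩
      one_smul := fun S => Subtype.ext <| by
        change S.1.image ((1 : H) • ·) = S.1
        simp
      mul_smul := fun g h S => Subtype.ext <| by
        change S.1.image ((g * h) • ·) = (S.1.image (h • ·)).image (g • ·)
        rw [Finset.image_image]
        exact congrArg (fun f => S.1.image f) (funext fun x => mul_smul g h x) }
  have hdvd : 2 ∣ Nat.card V := by
    have : (2 : ℕ) ∣ Fintype.card V := by
      rw [← ZMod.natCast_eq_zero_iff]
      have := Finset.sum_involution (s := (Finset.univ : Finset V)) (f := fun _ => (1 : ZMod 2))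
        (fun T _ => ⟨symmDiff T.1 S, hsymm _ T.2 _ hS⟩) (fun _ _ => by decide)
        (fun T _ _ h => hne (symmDiff_eq_left.1 (congrArg Subtype.val h)))
        (fun _ _ => Finset.mem_univ _)
        (fun T _ => Subtype.ext (symmDiff_symmDiff_cancel_right _ _))
      simpa using this
    rwa [Nat.card_eq_fintype_card]
  obtain ⟨T, hT, hT0⟩ := hH.exists_fixed_point_of_prime_dvd_card_of_fixed_point V hdvd
    (a := ⟨∅, h0⟩) (fun g => Subtype.ext (Finset.image_empty _))
  obtain ⟨x, hx⟩ : T.1.Nonempty :=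
    Finset.nonempty_iff_ne_empty.2 fun h => hT0 (Subtype.ext h.symm)
  suffices T.1 = Finset.univ from this ▸ T.2
  refine Finset.eq_univ_of_forall fun y => ?_
  obtain ⟨g, rfl⟩ := MulAction.exists_smul_eq H x y
  have : T.1.image (g • ·) = T.1 := congrArg Subtype.val (hT g)
  rw [← this]
  exact Finset.mem_image_of_mem _ hx

namespace Arboreal

/-! ### The vertices of the tree of a quadratic polynomial -/

/-- The quadratic map `x ↦ (x - γ) ^ 2 + e`, with critical point `γ` and critical value `e`. -/
def quad {R : Type*} [CommRing R] (γ e x : R) : R := (x - γ) ^ 2 + e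

theorem map_quad {R S F : Type*} [CommRing R] [CommRing S] [FunLike F R S] [RingHomClass F R S]
    (f : F) (γ e x : R) : f (quad γ e x) = quad (f γ) (f e) (f x) := by
  simp [quad]

theorem map_iterate_quad {R S F : Type*} [CommRing R] [CommRing S] [FunLike F R S]
    [RingHomClass F R S] (f : F) (γ e x : R) (n : ℕ) :
    f ((quad γ e)^[n] x) = (quad (f γ) (f e))^[n] (f x) :=
  Function.Semiconj.iterate_right (f := f) (fun y => map_quad f γ e y) n x

section Vertices

variable {L : Type*} [Field L] {γ e : L} {r : L → L}

theorem quad_eq_quad_iff {x y : L} : quad γ e x = quad γ e y ↔ x = y ∨ x = 2 * γ - y := by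
  rw [quad, quad, add_left_inj, sq_eq_sq_iff_eq_or_eq_neg, sub_left_inj,
    show -(y - γ) = (2 * γ - y) - γ by ring, sub_left_inj]

theorem quad_eq_iff (hr : ∀ α, r α ^ 2 = α - e) {x y : L} :
    quad γ e x = y ↔ x = γ + r y ∨ x = γ - r y := by
  rw [quad, ← eq_sub_iff_add_eq, ← hr, sq_eq_sq_iff_eq_or_eq_neg, sub_eq_iff_eq_add',
    sub_eq_iff_eq_add', sub_eq_add_neg]

open Classical in
/-- The roots of the `n`-th iterate of `quad γ e`, listed with the help of a function `r` choosing a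
square root of `α - e` for each `α`. -/
noncomputable def vertices (γ : L) (r : L → L) : ℕ → Finset L
  | 0 => {0}
  | n + 1 => (vertices γ r n).image (γ + r ·) ∪ (vertices γ r n).image (γ - r ·)

theorem mem_vertices (hr : ∀ α, r α ^ 2 = α - e) {n : ℕ} {α : L} :
    α ∈ vertices γ r n ↔ (quad γ e)^[n] α = 0 := by
  classical
  induction n generalizing α with
  | zero => simp [vertices]
  | succ n ih =>
    rw [Function.iterate_succ_apply, ← ih, vertices, Finset.mem_union, Finset.mem_image,
      Finset.mem_image]
    constructor
    · rintro (⟨β, hβ, rfl⟩ | ⟨β, hβ, rfl⟩)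
      · rwa [(quad_eq_iff hr).2 (Or.inl rfl)]
      · rwa [(quad_eq_iff hr).2 (Or.inr rfl)]
    · intro h
      rcases (quad_eq_iff (γ := γ) hr).1 (rfl : quad γ e α = _) with h1 | h1
      · exact Or.inl ⟨_, h, h1.symm⟩
      · exact Or.inr ⟨_, h, h1.symm⟩

theorem ne_critical_value (hc : ∀ n, (quad γ e)^[n] e ≠ 0) {n : ℕ} {α : L}
    (hα : (quad γ e)^[n] α = 0) : α - e ≠ 0 := fun h =>
  hc n (sub_eq_zero.1 h ▸ hα)

theorem prod_vertices [CharZero L] (hr : ∀ α, r α ^ 2 = α - e)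
    (hc : ∀ n, (quad γ e)^[n] e ≠ 0) (n : ℕ) (w : L) :
    ∏ α ∈ vertices γ r n, (w - α) = (quad γ e)^[n] w := by
  classical
  induction n generalizing w with
  | zero => simp [vertices]
  | succ n ih =>
    have hinj : ∀ α β : L, r α ^ 2 = r β ^ 2 → α = β := fun α β h => by
      rwa [hr, hr, sub_left_inj] at h
    rw [vertices, Finset.prod_union, Finset.prod_image, Finset.prod_image,
      ← Finset.prod_mul_distrib, Function.iterate_succ_apply, ← ih]
    · refine Finset.prod_congr rfl fun α _ => ?_
      have := hr α
      rw [quad]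
      linear_combination -this
    · exact fun α _ β _ h => hinj α β (by rw [sub_right_inj.1 h])
    · exact fun α _ β _ h => hinj α β (by rw [add_right_inj _ |>.1 h])
    · rw [Finset.disjoint_left]
      intro x h1 h2
      obtain ⟨α, hα, rfl⟩ := Finset.mem_image.1 h1
      obtain ⟨β, hβ, h⟩ := Finset.mem_image.1 h2
      have h' : -r β = r α := by linear_combination h
      have hαβ : β = α := hinj β α (by rw [← h', neg_sq])
      subst hαβ
      have h0 : r β = 0 := by
        have : 2 * r β = 0 := by linear_combination -h'
        simpa using this
      exact ne_critical_value hc ((mem_vertices hr).1 hβ) (by rw [← hr, h0]; ring)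

/-- Products that are squares up to a common factor `x` are closed under symmetric difference. -/
theorem prod_symmDiff_eq_sq {K ι : Type*} [Field K] [Algebra K L] [DecidableEq ι]
    (E : IntermediateField K L)
    {f : ι → L} {S T : Finset ι} {x z w : L} (hx : x ∈ E) (hx0 : x ≠ 0)
    (hf : ∀ i ∈ S, f i ∈ E) (hf0 : ∀ i ∈ S, f i ≠ 0) (hz : z ∈ E) (hw : w ∈ E)
    (hS : x * ∏ i ∈ S, f i = z ^ 2) (hT : x * ∏ i ∈ T, f i = w ^ 2) :
    ∃ v ∈ E, ∏ i ∈ symmDiff S T, f i = v ^ 2 := by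
  have hne : ∏ i ∈ S ∩ T, f i ≠ 0 :=
    Finset.prod_ne_zero_iff.2 fun i hi => hf0 i (Finset.mem_inter.1 hi).1
  refine ⟨z * w / (x * ∏ i ∈ S ∩ T, f i), div_mem (mul_mem hz hw) (mul_mem hx
    (prod_mem fun i hi => hf i (Finset.mem_inter.1 hi).1)), ?_⟩
  rw [div_pow, mul_pow, ← hS, ← hT, eq_div_iff (pow_ne_zero 2 (mul_ne_zero hx0 hne))]
  rw [← Finset.prod_sdiff (Finset.inter_subset_left : S ∩ T ⊆ S),
    ← Finset.prod_sdiff (Finset.inter_subset_right : S ∩ T ⊆ T), Finset.sdiff_inter_self_left,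
    Finset.sdiff_inter_self_right, symmDiff_def, Finset.sup_eq_union,
    Finset.prod_union (by exact disjoint_sdiff_sdiff)]
  ring

end Vertices

/-! ### Galois action on the levels -/

section Levels

variable {K : Type*} [Field K] (L : Type*) [Field L] [Algebra K L] (γ e : K)

/-- The map `x ↦ (x - γ) ^ 2 + e` on an extension `L` of the field containing `γ` and `e`. -/
abbrev quadOn : L → L := quad (algebraMap K L γ) (algebraMap K L e)

/-- The field generated by the first `n` levels of the tree. -/
def quadField (n : ℕ) : IntermediateField K L :=
  IntermediateField.adjoin K {α | ∃ i ≤ n, (quadOn L γ e)^[i] α = 0}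

variable {L γ e}

theorem mem_quadField {n i : ℕ} (hi : i ≤ n) {α : L} (hα : (quadOn L γ e)^[i] α = 0) :
    α ∈ quadField L γ e n :=
  IntermediateField.subset_adjoin K _ ⟨i, hi, hα⟩

theorem algEquiv_iterate (σ : L ≃ₐ[K] L) (n : ℕ) (α : L) :
    (quadOn L γ e)^[n] (σ α) = σ ((quadOn L γ e)^[n] α) := by
  rw [map_iterate_quad, AlgEquiv.commutes, AlgEquiv.commutes]

theorem algEquiv_root (σ : L ≃ₐ[K] L) {n : ℕ} {α : L} (h : (quadOn L γ e)^[n] α = 0) :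
    (quadOn L γ e)^[n] (σ α) = 0 := by
  rw [algEquiv_iterate, h, map_zero]

theorem algEquiv_mem_quadField (σ : L ≃ₐ[K] L) {n : ℕ} {x : L} (hx : x ∈ quadField L γ e n) :
    σ x ∈ quadField L γ e n := by
  have h : (quadField L γ e n).map (σ : L →ₐ[K] L) ≤ quadField L γ e n := by
    rw [quadField, IntermediateField.adjoin_map]
    refine IntermediateField.adjoin.mono K _ _ ?_
    rintro _ ⟨α, ⟨i, hi, hα⟩, rfl⟩
    exact ⟨i, hi, algEquiv_root σ hα⟩
  exact h ⟨x, hx, rfl⟩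

/-- The Galois group acts on the first `n` levels through a `2`-group. -/
theorem pow_two_pow_fixes (σ : L ≃ₐ[K] L) {n : ℕ} {α : L} (hα : (quadOn L γ e)^[n] α = 0) :
    (σ ^ 2 ^ n) α = α := by
  induction n generalizing α with
  | zero =>
    have : α = 0 := hα
    rw [this, map_zero]
  | succ n ih =>
    rw [pow_succ, pow_mul, pow_two, AlgEquiv.mul_apply]
    set τ := σ ^ 2 ^ n
    have h : quadOn L γ e (τ α) = quadOn L γ e α := by
      rw [← Function.iterate_one (quadOn L γ e), algEquiv_iterate τ 1 α]
      exact ih hα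
    rcases quad_eq_quad_iff.1 h with h | h
    · rw [h, h]
    · rw [h, map_sub, h, map_mul, AlgEquiv.commutes, map_ofNat]
      ring

variable {r : L → L}

theorem quadField_succ_le (hr : ∀ α, r α ^ 2 = α - algebraMap K L e) (n : ℕ) :
    quadField L γ e (n + 1) ≤ IntermediateField.adjoin K
      ({α | ∃ i ≤ n, (quadOn L γ e)^[i] α = 0} ∪ r '' (vertices (algebraMap K L γ) r n)) := by
  refine IntermediateField.adjoin_le_iff.2 ?_
  rintro α ⟨i, hi, hα⟩
  rcases hi.lt_or_eq with hi | rfl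
  · exact IntermediateField.subset_adjoin K _ (Or.inl ⟨i, Nat.lt_succ_iff.1 hi, hα⟩)
  · have hm : r (quadOn L γ e α) ∈ IntermediateField.adjoin K
      ({α | ∃ i ≤ n, (quadOn L γ e)^[i] α = 0} ∪ r '' (vertices (algebraMap K L γ) r n)) :=
      IntermediateField.subset_adjoin K _ (Or.inr ⟨_, (mem_vertices hr).2 hα, rfl⟩)
    rcases (quad_eq_iff hr).1 (rfl : quadOn L γ e α = _) with h | h <;> rw [SetLike.mem_coe, h]
    · exact add_mem (algebraMap_mem _ _) hm
    · exact sub_mem (algebraMap_mem _ _) hm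

/-- The elements `α - e`, for `α` of level `n`, are independent modulo squares in the field of
level `n`. -/
def LevelIndep (γ e : K) (r : L → L) (n : ℕ) : Prop :=
  ∀ S ⊆ vertices (algebraMap K L γ) r n, ∀ z ∈ quadField L γ e n,
    ∏ α ∈ S, (α - algebraMap K L e) = z ^ 2 → S = ∅

/-- The Galois group is transitive on level `n`. -/
def LevelTransitive (L : Type*) [Field L] [Algebra K L] (γ e : K) (n : ℕ) : Prop :=
  ∀ α β : L, (quadOn L γ e)^[n] α = 0 → (quadOn L γ e)^[n] β = 0 → ∃ σ : L ≃ₐ[K] L, σ α = β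

/-- An element of `K` that is a square in the field of level `n` is, up to sign, a square times
some of the critical orbit elements `φ(γ), …, φⁿ(γ)`, where `φ = quad γ e`; as `e = φ(γ)`, the
element `φʲ⁺¹(γ)` is written `φʲ(e)`. -/
def LevelDescent (L : Type*) [Field L] [Algebra K L] (γ e : K) (n : ℕ) : Prop :=
  ∀ x : K, ∀ y ∈ quadField L γ e n, y ^ 2 = algebraMap K L x →
    ∃ J ⊆ Finset.range n, ∃ ε : K, ε ^ 2 = 1 ∧ IsSquare (ε * x * ∏ j ∈ J, (quad γ e)^[j] e)

/-- The critical orbit elements `φ(γ), φ²(γ), …` are independent modulo squares and signs,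
where `φ = quad γ e`. -/
def CriticalIndep (γ e : K) : Prop :=
  ∀ J : Finset ℕ, J.Nonempty → ∀ ε : K, ε ^ 2 = 1 → ¬IsSquare (ε * ∏ j ∈ J, (quad γ e)^[j] e)

theorem CriticalIndep.ne_zero (h : CriticalIndep γ e) (L : Type*) [Field L] [Algebra K L] (n : ℕ) :
    (quadOn L γ e)^[n] (algebraMap K L e) ≠ 0 := by
  rw [← map_iterate_quad, Ne, map_eq_zero]
  intro h0
  exact h {n} (Finset.singleton_nonempty n) 1 (one_pow 2) (by simp [h0])

theorem exists_prod_sub_critical_value [CharZero K] (h : CriticalIndep γ e)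
    (hr : ∀ α, r α ^ 2 = α - algebraMap K L e) (n : ℕ) :
    ∃ ε : K, ε ^ 2 = 1 ∧ ∏ α ∈ vertices (algebraMap K L γ) r n, (α - algebraMap K L e) =
      algebraMap K L (ε * (quad γ e)^[n] e) := by
  have : CharZero L := charZero_of_injective_algebraMap (algebraMap K L).injective
  refine ⟨(-1) ^ (vertices (algebraMap K L γ) r n).card, by rw [← pow_mul, mul_comm, pow_mul]; simp,
    ?_⟩
  rw [map_mul, map_iterate_quad, ← prod_vertices hr (h.ne_zero L), map_pow, map_neg, map_one,
    ← Finset.prod_const, ← Finset.prod_mul_distrib]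
  exact Finset.prod_congr rfl fun α _ => by ring

/-- Sign changes of the square roots `r α` over the field of level `n`. -/
theorem LevelIndep.exists_flip [CharZero K] [IsGalois K L]
    (hr : ∀ α, r α ^ 2 = α - algebraMap K L e) {n : ℕ} (hA : LevelIndep γ e r n) (T : Set L) :
    ∃ σ : L ≃ₐ[K] L, (∀ x ∈ quadField L γ e n, σ x = x) ∧
      ∀ α, (quadOn L γ e)^[n] α = 0 → (α ∈ T → σ (r α) = -r α) ∧ (α ∉ T → σ (r α) = r α) := by
  obtain ⟨σ, hσ, hσT⟩ := exists_algEquiv_flip r (vertices (algebraMap K L γ) r n)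
    (A := {α | ∃ i ≤ n, (quadOn L γ e)^[i] α = 0})
    (fun α hα => by
      rw [hr]
      exact sub_mem (mem_quadField le_rfl ((mem_vertices hr).1 hα)) (algebraMap_mem _ _))
    (fun S hS z hz h => hA S hS z hz (by simpa only [hr] using h)) T
  exact ⟨σ, hσ, fun α hα => hσT α ((mem_vertices hr).2 hα)⟩

theorem LevelTransitive.succ [CharZero K] [IsGalois K L]
    (hr : ∀ α, r α ^ 2 = α - algebraMap K L e) {n : ℕ} (hA : LevelIndep γ e r n)
    (hB : LevelTransitive L γ e n) : LevelTransitive L γ e (n + 1) := by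
  intro α β hα hβ
  obtain ⟨σ, hσ⟩ := hB (quadOn L γ e α) (quadOn L γ e β) hα hβ
  have h : quadOn L γ e (σ α) = quadOn L γ e β := by
    rw [← hσ]
    exact algEquiv_iterate σ 1 α
  rcases quad_eq_quad_iff.1 h with h1 | h1
  · exact ⟨σ, h1⟩
  · obtain ⟨τ, -, hτ⟩ := hA.exists_flip hr Set.univ
    have h2 := (hτ _ hβ).1 trivial
    refine ⟨τ * σ, ?_⟩
    rw [AlgEquiv.mul_apply, h1, map_sub, map_mul, AlgEquiv.commutes, map_ofNat]
    rcases (quad_eq_iff hr).1 (rfl : quadOn L γ e β = _) with h3 | h3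
    · have h4 := congrArg τ h3
      rw [map_add, AlgEquiv.commutes, h2] at h4
      linear_combination -h4 - h3
    · have h4 := congrArg τ h3
      rw [map_sub, AlgEquiv.commutes, h2] at h4
      linear_combination -h4 - h3

theorem LevelDescent.succ [CharZero K] [IsGalois K L] (hc : CriticalIndep γ e)
    (hr : ∀ α, r α ^ 2 = α - algebraMap K L e) {n : ℕ} (hA : LevelIndep γ e r n)
    (hB : LevelTransitive L γ e n) (hC : LevelDescent L γ e n) : LevelDescent L γ e (n + 1) := by
  classical
  intro x y hy hxy
  rcases eq_or_ne x 0 with rfl | hx0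
  · exact ⟨∅, Finset.empty_subset _, 1, one_pow 2, by simp⟩
  have hx : algebraMap K L x ∈ quadField L γ e n := algebraMap_mem _ _
  have hx0' : algebraMap K L x ≠ 0 := by simpa using hx0
  have hmem : ∀ α ∈ vertices (algebraMap K L γ) r n,
      α - algebraMap K L e ∈ quadField L γ e n := fun α hα =>
    sub_mem (mem_quadField le_rfl ((mem_vertices hr).1 hα)) (algebraMap_mem _ _)
  obtain ⟨S, hS, z, hz, h⟩ := exists_mul_prod_eq_sq r (vertices (algebraMap K L γ) r n)
    (fun α hα => by rw [hr]; exact hmem α hα) hx (quadField_succ_le hr n hy) hxy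
  replace hz : z ∈ quadField L γ e n := hz
  simp only [hr] at h
  rcases S.eq_empty_or_nonempty with rfl | ⟨α, hα⟩
  · obtain ⟨J, hJ, ε, hε, hsq⟩ := hC x z hz (by rw [← h, Finset.prod_empty, mul_one])
    exact ⟨J, hJ.trans (Finset.range_mono n.le_succ), ε, hε, hsq⟩
  -- By independence `S` is Galois stable, and by transitivity it is the whole level.
  have hSall : S = vertices (algebraMap K L γ) r n := by
    refine hS.antisymm fun β hβ => ?_
    obtain ⟨σ, rfl⟩ := hB α β ((mem_vertices hr).1 (hS hα)) ((mem_vertices hr).1 hβ)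
    have hT : algebraMap K L x * ∏ α ∈ S.image σ, (α - algebraMap K L e) = (σ z) ^ 2 := by
      rw [← map_pow, ← h, map_mul, AlgEquiv.commutes, map_prod,
        Finset.prod_image σ.injective.injOn]
      simp
    obtain ⟨v, hv, hvS⟩ := prod_symmDiff_eq_sq (quadField L γ e n) hx hx0'
      (fun α hα => hmem α (hS hα))
      (fun α hα => ne_critical_value (hc.ne_zero L) ((mem_vertices hr).1 (hS hα))) hz
      (algEquiv_mem_quadField σ hz) h hT
    have hsub : symmDiff S (S.image σ) ⊆ vertices (algebraMap K L γ) r n := by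
      refine (symmDiff_le_sup (a := S) (b := S.image σ)).trans (sup_le hS ?_)
      intro β hβ
      obtain ⟨α, hα, rfl⟩ := Finset.mem_image.1 hβ
      exact (mem_vertices hr).2 (algEquiv_root σ ((mem_vertices hr).1 (hS hα)))
    have heq : S = S.image σ := symmDiff_eq_bot.1 (hA _ hsub v hv hvS)
    rw [heq]
    exact Finset.mem_image_of_mem _ hα
  obtain ⟨ε, hε, hprod⟩ := exists_prod_sub_critical_value hc hr n
  rw [hSall, hprod, ← map_mul] at h
  obtain ⟨J, hJ, ε', hε', hsq⟩ := hC _ z hz h.symm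
  refine ⟨insert n J, Finset.insert_subset (Finset.self_mem_range_succ n)
    (hJ.trans (Finset.range_mono n.le_succ)), ε' * ε, by rw [mul_pow, hε, hε', one_mul], ?_⟩
  rw [Finset.prod_insert fun hn => Finset.notMem_range_self (hJ hn)]
  convert hsq using 1
  ring

theorem LevelIndep.of_transitive [CharZero K] (hc : CriticalIndep γ e)
    (hr : ∀ α, r α ^ 2 = α - algebraMap K L e) {n : ℕ}
    (hB : LevelTransitive L γ e n) (hC : LevelDescent L γ e n) : LevelIndep γ e r n := by
  classical
  intro S hS z hz hSz
  by_contra hne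
  let Λ := {α // α ∈ vertices (algebraMap K L γ) r n}
  have hΛ : ∀ α : Λ, (quadOn L γ e)^[n] α = 0 := fun α => (mem_vertices hr).1 α.2
  let act : MulAction (L ≃ₐ[K] L) Λ :=
    { smul := fun σ α => ⟨σ α, (mem_vertices hr).2 (algEquiv_root σ (hΛ α))⟩
      one_smul := fun α => rfl
      mul_smul := fun σ τ α => rfl }
  let H := (MulAction.toPermHom (L ≃ₐ[K] L) Λ).range
  have hH : IsPGroup 2 H := by
    rintro ⟨_, σ, rfl⟩
    refine ⟨n, Subtype.ext ?_⟩
    rw [Subgroup.coe_pow, ← map_pow, Subgroup.coe_one]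
    ext α
    exact pow_two_pow_fixes σ (hΛ α)
  have htrans : MulAction.IsPretransitive H Λ := ⟨fun α β => by
    obtain ⟨σ, hσ⟩ := hB α β (hΛ α) (hΛ β)
    exact ⟨⟨_, σ, rfl⟩, Subtype.ext hσ⟩⟩
  let V : Set (Finset Λ) :=
    {S | ∃ z ∈ quadField L γ e n, ∏ α ∈ S, ((α : L) - algebraMap K L e) = z ^ 2}
  have huniv : Finset.univ ∈ V := by
    refine univ_of_symmDiff_closed hH V ⟨1, one_mem _, by simp⟩ ?_ ?_
      (S := S.subtype (· ∈ vertices (algebraMap K L γ) r n)) ⟨z, hz, ?_⟩ ?_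
    · rintro S ⟨z, hz, hSz⟩ T ⟨w, hw, hTw⟩
      exact prod_symmDiff_eq_sq (x := 1) _ (one_mem _) one_ne_zero
        (fun α _ => sub_mem (mem_quadField le_rfl (hΛ α)) (algebraMap_mem _ _))
        (fun α _ => ne_critical_value (hc.ne_zero L) (hΛ α)) hz hw (by rw [one_mul, hSz])
        (by rw [one_mul, hTw])
    · rintro ⟨_, σ, rfl⟩ S ⟨z, hz, hSz⟩
      refine ⟨σ z, algEquiv_mem_quadField σ hz, ?_⟩
      rw [Finset.prod_image (MulAction.injective _).injOn, ← map_pow, ← hSz, map_prod]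
      refine Finset.prod_congr rfl fun α _ => ?_
      rw [map_sub, AlgEquiv.commutes]
      rfl
    · rw [← hSz]
      exact Finset.prod_subtype_of_mem (fun α => α - algebraMap K L e) fun α hα => hS hα
    · obtain ⟨α, hα⟩ := Finset.nonempty_iff_ne_empty.2 hne
      exact Finset.nonempty_iff_ne_empty.1 ⟨⟨α, hS hα⟩, Finset.mem_subtype.2 hα⟩
  obtain ⟨w, hw, hprod⟩ := huniv
  obtain ⟨ε, hε, hprod'⟩ := exists_prod_sub_critical_value (r := r) hc hr n
  rw [← Finset.prod_coe_sort] at hprod'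
  obtain ⟨J, hJ, ε', hε', hsq⟩ := hC _ w hw (hprod.symm.trans hprod')
  refine hc (insert n J) (Finset.insert_nonempty n J) (ε' * ε)
    (by rw [mul_pow, hε, hε', one_mul]) ?_
  rw [Finset.prod_insert fun hn => Finset.notMem_range_self (hJ hn)]
  convert hsq using 1
  ring

theorem levelTransitive_and_levelDescent [CharZero K] [IsGalois K L] (hc : CriticalIndep γ e)
    (hr : ∀ α, r α ^ 2 = α - algebraMap K L e) (n : ℕ) :
    LevelTransitive L γ e n ∧ LevelDescent L γ e n := by
  induction n with
  | zero =>
    refine ⟨fun α β hα hβ => ⟨1, ?_⟩, fun x y hy hxy => ⟨∅, subset_rfl, 1, one_pow 2, ?_⟩⟩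
    · exact Eq.trans hα (Eq.symm hβ)
    · have hbot : quadField L γ e 0 = ⊥ := by
        rw [quadField, IntermediateField.adjoin_eq_bot_iff]
        rintro α ⟨i, hi, hα⟩
        obtain rfl := Nat.le_zero.1 hi
        have hα' : α = 0 := hα
        rw [hα']
        exact zero_mem _
      rw [hbot, IntermediateField.mem_bot] at hy
      obtain ⟨y, rfl⟩ := hy
      rw [← map_pow] at hxy
      refine ⟨y, ?_⟩
      rw [← (algebraMap K L).injective hxy]
      simp [pow_two]
  | succ n ih =>
    have hA := LevelIndep.of_transitive hc hr ih.1 ih.2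
    exact ⟨ih.1.succ hr hA, ih.2.succ hc hr hA ih.1⟩

theorem levelIndep [CharZero K] [IsGalois K L] (hc : CriticalIndep γ e)
    (hr : ∀ α, r α ^ 2 = α - algebraMap K L e) (n : ℕ) : LevelIndep γ e r n :=
  LevelIndep.of_transitive hc hr (levelTransitive_and_levelDescent hc hr n).1
    (levelTransitive_and_levelDescent hc hr n).2

/-- No vertex of positive level is the root: it would be fixed by the Galois group and by the
symmetry `x ↦ 2 * γ - x`, so that the critical point would be periodic. -/
theorem iterate_zero_ne_zero [CharZero K] [IsGalois K L] (hc : CriticalIndep γ e)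
    (hr : ∀ α, r α ^ 2 = α - algebraMap K L e) {n : ℕ} (hn : n ≠ 0) :
    (quadOn L γ e)^[n] 0 ≠ 0 := by
  obtain ⟨n, rfl⟩ := Nat.exists_eq_succ_of_ne_zero hn
  have : CharZero L := charZero_of_injective_algebraMap (algebraMap K L).injective
  intro h
  have h' : (quadOn L γ e)^[n + 1] (2 * algebraMap K L γ - 0) = 0 := by
    rw [Function.iterate_succ_apply] at h ⊢
    have hq : quadOn L γ e (2 * algebraMap K L γ - 0) = quadOn L γ e 0 :=
      quad_eq_quad_iff.2 (Or.inr rfl)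
    rwa [hq]
  obtain ⟨σ, hσ⟩ := (levelTransitive_and_levelDescent hc hr (n + 1)).1 _ _ h h'
  have h0 : algebraMap K L γ = 0 := by simpa using hσ.symm
  refine hc.ne_zero L n ?_
  rw [Function.iterate_succ_apply] at h
  convert h using 2
  simp [quad, h0]

end Levels

/-! ### The arboreal representation of a quadratic polynomial -/

section Representation

variable {K : Type*} [Field K] {L : Type*} [Field L] [Algebra K L] {γ e : K}

theorem aeval_quadratic (α : L) :
    aeval α ((X - C γ) ^ 2 + C e : K[X]) = quadOn L γ e α := by
  simp [quad]

theorem aeval_iter_quadratic (n : ℕ) (α : L) :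
    aeval α (iter ((X - C γ) ^ 2 + C e : K[X]) n) = (quadOn L γ e)^[n] α := by
  induction n with
  | zero => simp [iter]
  | succ n ih =>
    rw [iter, Function.iterate_succ_apply', Function.iterate_succ_apply', ← iter, aeval_comp,
      aeval_quadratic, ih]

theorem mem_treeLevel_quadratic {n : ℕ} {α : L} :
    α ∈ treeLevel L ((X - C γ) ^ 2 + C e : K[X]) n ↔ ∃ i ≤ n, (quadOn L γ e)^[i] α = 0 := by
  simp only [treeLevel, Set.mem_ofPred_eq, aeval_iter_quadratic]

theorem mem_treeSet_quadratic {α : L} :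
    α ∈ treeSet L ((X - C γ) ^ 2 + C e : K[X]) ↔ ∃ i, (quadOn L γ e)^[i] α = 0 := by
  simp only [treeSet, Set.mem_iUnion, mem_treeLevel_quadratic]
  exact ⟨fun ⟨_, i, _, h⟩ => ⟨i, h⟩, fun ⟨i, h⟩ => ⟨i, i, le_rfl, h⟩⟩

theorem levelField_quadratic (n : ℕ) :
    levelField L ((X - C γ) ^ 2 + C e : K[X]) n = quadField L γ e n := by
  rw [levelField, quadField]
  congr 1
  ext α
  exact mem_treeLevel_quadratic

theorem normal_levelField [Normal K L] (n : ℕ) :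
    Normal K (levelField L ((X - C γ) ^ 2 + C e : K[X]) n) := by
  rw [IntermediateField.normal_iff_forall_map_le', levelField_quadratic]
  rintro σ _ ⟨x, hx, rfl⟩
  exact algEquiv_mem_quadField σ hx

theorem algHom_ext_levelField {F : K[X]} {n : ℕ} {σ τ : levelField L F n →ₐ[K] L}
    (h : ∀ α (hα : α ∈ treeLevel L F n),
      σ ⟨α, mem_levelField hα⟩ = τ ⟨α, mem_levelField hα⟩) : σ = τ :=
  IntermediateField.algHom_ext_of_eq_adjoin K rfl h

theorem arborealRep_injective (F : K[X]) : Function.Injective (arborealRep L F) := by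
  rw [injective_iff_map_eq_one]
  intro σ hσ
  have hact : ∀ α, act σ α = α := fun α =>
    congrArg (fun f : treeAut L F => f.1 α) hσ
  refine Subtype.ext (funext fun n => AlgEquiv.ext fun x => Subtype.ext ?_)
  have : (levelField L F n).val.comp (σ.1 n : levelField L F n →ₐ[K] levelField L F n) =
      (levelField L F n).val := by
    refine algHom_ext_levelField fun α hα => ?_
    have h := act_eq σ ⟨α, Set.mem_iUnion.2 ⟨n, hα⟩⟩ (mem_levelField hα)
    rw [hact] at h
    exact h.symm
  exact DFunLike.congr_fun this x

variable [CharZero K] [IsGalois K L] {r : L → L}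

/-- No vertex of positive level is periodic. -/
theorem iterate_ne_self (hc : CriticalIndep γ e) (hr : ∀ α, r α ^ 2 = α - algebraMap K L e)
    {n k : ℕ} {α : L} (hα : (quadOn L γ e)^[n + 1] α = 0) :
    (quadOn L γ e)^[k + 1] α ≠ α := by
  intro h
  have h1 : (quadOn L γ e)^[(k + 1) * (n + 1)] α = α := by
    rw [Function.iterate_mul]
    exact Function.iterate_fixed h _
  rw [add_mul, one_mul, Function.iterate_add_apply, hα] at h1
  rw [← h1, ← Function.iterate_add_apply] at hα
  exact iterate_zero_ne_zero hc hr (by omega) hα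

theorem quad_zero_notMem_treeSet (hc : CriticalIndep γ e)
    (hr : ∀ α, r α ^ 2 = α - algebraMap K L e) :
    quadOn L γ e 0 ∉ treeSet L ((X - C γ) ^ 2 + C e : K[X]) := by
  rw [mem_treeSet_quadratic]
  rintro ⟨i, hi⟩
  exact iterate_zero_ne_zero hc hr i.succ_ne_zero hi

/-- Automorphisms of the rooted tree preserve the levels and commute with the polynomial. -/
theorem treeAut_level_and_quad (hc : CriticalIndep γ e)
    (hr : ∀ α, r α ^ 2 = α - algebraMap K L e)
    (f : treeAut L ((X - C γ) ^ 2 + C e : K[X])) (n : ℕ) :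
    ∀ α : treeSet L ((X - C γ) ^ 2 + C e : K[X]), (quadOn L γ e)^[n] (α : L) = 0 →
      (quadOn L γ e)^[n] (f.1 α : L) = 0 ∧
      ∀ β : treeSet L ((X - C γ) ^ 2 + C e : K[X]), quadOn L γ e α = β →
        quadOn L γ e (f.1 α) = f.1 β := by
  have hroot : ∀ α : treeSet L ((X - C γ) ^ 2 + C e : K[X]), (α : L) = 0 → (f.1 α : L) = 0 := by
    intro α hα
    obtain rfl : α = root L _ := Subtype.ext hα
    rw [f.2]
    rfl
  induction n with
  | zero =>
    intro α hα
    have hα' : (α : L) = 0 := hα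
    refine ⟨hroot α hα', fun β hβ => ?_⟩
    rw [hα'] at hβ
    exact (quad_zero_notMem_treeSet hc hr (hβ ▸ β.2)).elim
  | succ n ih =>
    intro α hα
    have key : ∀ β : treeSet L ((X - C γ) ^ 2 + C e : K[X]), quadOn L γ e α = β →
        quadOn L γ e (f.1 α) = f.1 β := by
      intro β hβ
      have hβn : (quadOn L γ e)^[n] (β : L) = 0 := by
        rw [← hβ]
        exact hα
      have hne : α ≠ β := fun h =>
        iterate_ne_self (k := 0) hc hr hα (hβ.trans (congrArg Subtype.val h.symm))
      have hadj : (tree L ((X - C γ) ^ 2 + C e : K[X])).Adj α β := by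
        rw [tree, SimpleGraph.fromRel_adj]
        exact ⟨hne, Or.inl ((aeval_quadratic _).trans hβ)⟩
      have hadj' := (SimpleGraph.fromRel_adj _ _ _).1 (f.1.map_adj_iff.2 hadj)
      rcases hadj'.2 with h | h <;> rw [aeval_quadratic] at h
      · exact h
      exfalso
      -- Otherwise the parent of `f β` is `f α`, so `f` identifies `α` with the parent of `β`.
      cases n with
      | zero =>
        rw [hroot β hβn] at h
        exact quad_zero_notMem_treeSet hc hr (h ▸ (f.1 α).2)
      | succ n =>
        have hmem : quadOn L γ e (β : L) ∈ treeSet L ((X - C γ) ^ 2 + C e : K[X]) :=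
          mem_treeSet_quadratic.2 ⟨n, hβn⟩
        have h2 := (ih β hβn).2 ⟨_, hmem⟩ rfl
        have h3 : α = ⟨_, hmem⟩ := f.1.injective (Subtype.ext (h.symm.trans h2))
        refine iterate_ne_self (k := 1) hc hr hα ?_
        have h4 := (congrArg Subtype.val h3).symm
        rw [Subtype.coe_mk, ← hβ] at h4
        exact h4
    have hmem : quadOn L γ e (α : L) ∈ treeSet L ((X - C γ) ^ 2 + C e : K[X]) :=
      mem_treeSet_quadratic.2 ⟨n, hα⟩
    refine ⟨?_, key⟩
    rw [Function.iterate_succ_apply, key ⟨_, hmem⟩ rfl]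
    exact (ih ⟨_, hmem⟩ hα).1

/-- An automorphism of the rooted tree is induced by the Galois group on each finite level: a
lift to level `n` is corrected on level `n + 1` by sign changes of the square roots. -/
theorem exists_algEquiv_eq_on_level (hc : CriticalIndep γ e)
    (hr : ∀ α, r α ^ 2 = α - algebraMap K L e)
    (f : treeAut L ((X - C γ) ^ 2 + C e : K[X])) (n : ℕ) :
    ∃ σ : L ≃ₐ[K] L, ∀ α : treeSet L ((X - C γ) ^ 2 + C e : K[X]), ∀ i ≤ n,
      (quadOn L γ e)^[i] (α : L) = 0 → σ α = f.1 α := by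
  induction n with
  | zero =>
    refine ⟨1, fun α i hi hα => ?_⟩
    obtain rfl := Nat.le_zero.1 hi
    obtain rfl : α = root L _ := Subtype.ext hα
    rw [f.2]
    rfl
  | succ n ih =>
    obtain ⟨σ, hσ⟩ := ih
    let T : Set L := {β | ∃ h : algebraMap K L γ + r β ∈
      treeSet L ((X - C γ) ^ 2 + C e : K[X]),
        σ (algebraMap K L γ + r β) ≠ f.1 ⟨algebraMap K L γ + r β, h⟩}
    obtain ⟨τ, hτ, hτT⟩ := (levelIndep hc hr n).exists_flip hr T
    refine ⟨σ * τ, fun α i hi hα => ?_⟩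
    rw [AlgEquiv.mul_apply]
    rcases hi.lt_or_eq with hi | rfl
    · rw [hτ _ (mem_quadField (Nat.lt_succ_iff.1 hi) hα)]
      exact hσ α i (Nat.lt_succ_iff.1 hi) hα
    obtain ⟨β, hβ⟩ : ∃ β, quadOn L γ e (α : L) = β := ⟨_, rfl⟩
    have hβn : (quadOn L γ e)^[n] β = 0 := hβ ▸ hα
    have hβT : β ∈ treeSet L ((X - C γ) ^ 2 + C e : K[X]) := mem_treeSet_quadratic.2 ⟨n, hβn⟩
    have hchild : ∀ a : treeSet L ((X - C γ) ^ 2 + C e : K[X]), quadOn L γ e (a : L) = β →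
        (f.1 a : L) = σ a ∨ (f.1 a : L) = 2 * algebraMap K L γ - σ a := by
      intro a ha
      have h0 : (quadOn L γ e)^[n + 1] (a : L) = 0 := by
        rw [Function.iterate_succ_apply, ha, hβn]
      rw [← quad_eq_quad_iff (e := algebraMap K L e)]
      refine ((treeAut_level_and_quad hc hr f (n + 1) a h0).2 ⟨β, hβT⟩ ha).trans ?_
      rw [← hσ ⟨β, hβT⟩ n le_rfl hβn]
      change σ β = _
      rw [← ha]
      exact (algEquiv_iterate σ 1 (a : L)).symm
    have hap : quadOn L γ e (algebraMap K L γ + r β) = β := (quad_eq_iff hr).2 (Or.inl rfl)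
    have ham : quadOn L γ e (algebraMap K L γ - r β) = β := (quad_eq_iff hr).2 (Or.inr rfl)
    let a : treeSet L ((X - C γ) ^ 2 + C e : K[X]) := ⟨algebraMap K L γ + r β,
      mem_treeSet_quadratic.2 ⟨n + 1, by rw [Function.iterate_succ_apply, hap, hβn]⟩⟩
    let b : treeSet L ((X - C γ) ^ 2 + C e : K[X]) := ⟨algebraMap K L γ - r β,
      mem_treeSet_quadratic.2 ⟨n + 1, by rw [Function.iterate_succ_apply, ham, hβn]⟩⟩
    have hσb : 2 * algebraMap K L γ - σ a = σ b := by
      rw [map_add, map_sub, AlgEquiv.commutes]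
      ring
    have hσa : 2 * algebraMap K L γ - σ b = σ a := by rw [← hσb]; ring
    have hfa := hchild a hap
    have hfb := hchild b ham
    rw [hσb] at hfa
    rw [hσa] at hfb
    have hinj : (f.1 a : L) = f.1 b → σ a = σ b := fun h => by
      rw [f.1.injective (Subtype.ext h)]
    by_cases hmem : β ∈ T
    · have hτβ := (hτT β hβn).1 hmem
      have hτa : τ a = b := by
        change τ (_ + _) = _ - _
        rw [map_add, AlgEquiv.commutes, hτβ, sub_eq_add_neg]
      have hτb : τ b = a := by
        change τ (_ - _) = _ + _
        rw [map_sub, AlgEquiv.commutes, hτβ, sub_neg_eq_add]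
      obtain ⟨_, hne⟩ := hmem
      have hfa' : (f.1 a : L) = σ b := hfa.resolve_left fun h => hne h.symm
      rcases (quad_eq_iff hr).1 hβ with h | h
      · obtain rfl : α = a := Subtype.ext h
        rw [hτa, hfa']
      · obtain rfl : α = b := Subtype.ext h
        rw [hτb]
        rcases hfb with h | h
        · rw [h]
          exact hinj (hfa'.trans h.symm)
        · exact h.symm
    · have hτβ := (hτT β hβn).2 hmem
      have hτa : τ a = a := by
        change τ (_ + _) = _ + _
        rw [map_add, AlgEquiv.commutes, hτβ]
      have hτb : τ b = b := by
        change τ (_ - _) = _ - _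
        rw [map_sub, AlgEquiv.commutes, hτβ]
      have hfa' : (f.1 a : L) = σ a := by
        by_contra hne
        exact hmem ⟨a.2, fun h => hne h.symm⟩
      rcases (quad_eq_iff hr).1 hβ with h | h
      · obtain rfl : α = a := Subtype.ext h
        rw [hτa, hfa']
      · obtain rfl : α = b := Subtype.ext h
        rw [hτb]
        rcases hfb with h | h
        · exact h.symm
        · rw [h]
          exact (hinj (hfa'.trans h.symm)).symm

theorem arborealRep_surjective (hc : CriticalIndep γ e)
    (hr : ∀ α, r α ^ 2 = α - algebraMap K L e) :
    Function.Surjective (arborealRep L ((X - C γ) ^ 2 + C e : K[X])) := by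
  intro f
  choose σ hσ using exists_algEquiv_eq_on_level hc hr f
  have hσ' : ∀ n α (hα : α ∈ treeLevel L ((X - C γ) ^ 2 + C e : K[X]) n),
      σ n α = f.1 ⟨α, Set.mem_iUnion.2 ⟨n, hα⟩⟩ := fun n α hα => by
    obtain ⟨i, hi, h⟩ := mem_treeLevel_quadratic.1 hα
    exact hσ n ⟨α, Set.mem_iUnion.2 ⟨n, hα⟩⟩ i hi h
  have hnormal := fun n => normal_levelField (K := K) (L := L) (γ := γ) (e := e) n
  let g : ∀ n, levelGroup L ((X - C γ) ^ 2 + C e : K[X]) n :=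
    fun n => (σ n).restrictNormal (levelField L ((X - C γ) ^ 2 + C e : K[X]) n)
  have hg : ∀ n x, (g n x : L) = σ n x := fun n x => AlgEquiv.restrictNormal_commutes (σ n) _ x
  have hcompat : g ∈ limitGroup L ((X - C γ) ^ 2 + C e : K[X]) := by
    intro m n hmn x hx
    rw [hg, hg]
    have : (σ n : L →ₐ[K] L).comp (levelField L ((X - C γ) ^ 2 + C e : K[X]) m).val =
        (σ m : L →ₐ[K] L).comp (levelField L ((X - C γ) ^ 2 + C e : K[X]) m).val := by
      refine algHom_ext_levelField fun α hα => ?_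
      exact (hσ' n α (treeLevel_mono L _ hmn hα)).trans (hσ' m α hα).symm
    exact DFunLike.congr_fun this ⟨x, hx⟩
  refine ⟨⟨g, hcompat⟩, Subtype.ext (RelIso.ext fun α => Subtype.ext ?_)⟩
  obtain ⟨n, hn⟩ := exists_level α
  exact (act_eq ⟨g, hcompat⟩ α (mem_levelField hn)).trans ((hg n _).trans (hσ' n _ hn))

/-- The arboreal representation of a quadratic polynomial is an isomorphism if its critical orbit is
independent modulo squares and signs. -/
theorem arborealRep_bijective [IsAlgClosed L] (hc : CriticalIndep γ e) :
    Function.Bijective (arborealRep L ((X - C γ) ^ 2 + C e : K[X])) := by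
  choose r hr using fun α : L => IsAlgClosed.exists_pow_nat_eq (α - algebraMap K L e) two_pos
  exact ⟨arborealRep_injective _, arborealRep_surjective hc hr⟩

end Representation

/-! ### The critical orbit over `k(t)` -/

section Family

variable {k : Type*} [Field k]

/-- Translation by `t ^ d` conjugates the family to `y ↦ y ^ 2 + m`. -/
theorem iterate_quad_translate (d : ℕ) (m : k) (n : ℕ) (y : k) :
    (quad (X ^ d : k[X]) (X ^ d + C m))^[n] (X ^ d + C y) =
      X ^ d + C ((quad 0 m)^[n] y) := by
  refine (Function.Semiconj.iterate_right (f := fun y : k => (X ^ d + C y : k[X]))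
    (fun y => ?_) n y).symm
  simp only [quad, map_add, map_pow, sub_zero]
  ring

theorem eval_family (d : ℕ) (m : k) :
    (fun x => (family d m).eval x) = quad (X ^ d : k[X]) (X ^ d + C m) := by
  funext x
  simp [family, quad]

theorem forwardOrbit_family (d : ℕ) (m : k) :
    forwardOrbit (family d m) (X ^ d) = Set.range fun n : ℕ => X ^ d + C ((quad 0 m)^[n] m) := by
  ext b
  simp only [forwardOrbit, Set.mem_ofPred_eq, Set.mem_range, eval_family]
  have h : ∀ n, (quad (X ^ d : k[X]) (X ^ d + C m))^[n + 1] (X ^ d) =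
      X ^ d + C ((quad 0 m)^[n] m) := fun n => by
    rw [Function.iterate_succ_apply, ← iterate_quad_translate]
    simp [quad]
  constructor
  · rintro ⟨n, hn, rfl⟩
    obtain ⟨n, rfl⟩ := Nat.exists_eq_add_of_le' hn
    exact ⟨n, (h n).symm⟩
  · rintro ⟨n, rfl⟩
    exact ⟨n + 1, by omega, (h n).symm⟩

/-- A sequence of iterates with infinite range is injective. -/
theorem injective_iterate_of_infinite {α : Type*} (f : α → α) (x : α)
    (h : (Set.range fun n : ℕ => f^[n] x).Infinite) : Function.Injective fun n : ℕ => f^[n] x := by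
  by_contra hinj
  obtain ⟨i, p, hp, hip⟩ : ∃ i p, 0 < p ∧ f^[i + p] x = f^[i] x := by
    simp only [Function.Injective] at hinj
    push Not at hinj
    obtain ⟨i, j, hij, hne⟩ := hinj
    rcases hne.lt_or_gt with h | h
    · exact ⟨i, j - i, by omega, by rw [Nat.add_sub_cancel' h.le]; exact hij.symm⟩
    · exact ⟨j, i - j, by omega, by rw [Nat.add_sub_cancel' h.le]; exact hij⟩
  refine h ((Set.finite_Iio (i + p)).image (fun n => f^[n] x) |>.subset ?_)
  rintro _ ⟨n, rfl⟩
  induction n using Nat.strong_induction_on with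
  | _ n ih =>
    rcases lt_or_ge n (i + p) with hn | hn
    · exact ⟨n, hn, rfl⟩
    · have heq : f^[n] x = f^[n - p] x := by
        rw [show n = (n - (i + p)) + (i + p) by omega, Function.iterate_add_apply, hip,
          ← Function.iterate_add_apply]
        congr 1
        omega
      have := ih (n - p) (by omega)
      simpa only [heq] using this

theorem not_isSquare_algebraMap_of_squarefree {p : k[X]} (hp : Squarefree p)
    (hdeg : p.natDegree ≠ 0) : ¬IsSquare (algebraMap k[X] (RatFunc k) p) := by
  rintro ⟨q, hq⟩
  obtain ⟨q, rfl⟩ := IsIntegrallyClosed.exists_algebraMap_eq_of_isIntegral_pow (R := k[X])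
    two_pos (x := q) (by rw [pow_two, ← hq]; exact isIntegral_algebraMap)
  rw [← map_mul, (IsFractionRing.injective k[X] (RatFunc k)).eq_iff] at hq
  have hu := hp q ⟨1, by rw [hq, mul_one]⟩
  exact hdeg (natDegree_eq_zero_of_isUnit (hq ▸ hu.mul hu))

/-- The polynomials `t ^ d + a` for distinct nonzero constants `a` are separable and pairwise
coprime, so that no nonempty product of them is a square in `k(t)`, even up to sign. -/
theorem criticalIndep_family [CharZero k] {d : ℕ} (hd : 1 ≤ d) {m : k}
    (h : (forwardOrbit (family d m) (X ^ d)).Infinite) :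
    CriticalIndep (algebraMap k[X] (RatFunc k) (X ^ d))
      (algebraMap k[X] (RatFunc k) (X ^ d + C m)) := by
  rw [forwardOrbit_family] at h
  have hinf : (Set.range fun n : ℕ => (quad 0 m)^[n] m).Infinite := by
    intro hfin
    refine h ((hfin.image fun y : k => (X ^ d + C y : k[X])).subset ?_)
    rintro _ ⟨n, rfl⟩
    exact ⟨_, ⟨n, rfl⟩, rfl⟩
  have hinj := injective_iterate_of_infinite _ _ hinf
  -- If `0` occurred in the orbit of `m`, it would be followed by `m` itself.
  have hne : ∀ n, (quad 0 m)^[n] m ≠ 0 := by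
    intro n hn
    have : n + 1 = 0 := hinj (by
      simp only [Function.iterate_succ_apply', hn, Function.iterate_zero_apply]
      simp [quad])
    omega
  intro J hJ ε hε
  set p : ℕ → k[X] := fun n => X ^ d + C ((quad 0 m)^[n] m) with hp
  have hprod : ∏ j ∈ J, (quad (algebraMap k[X] (RatFunc k) (X ^ d))
      (algebraMap k[X] (RatFunc k) (X ^ d + C m)))^[j]
        (algebraMap k[X] (RatFunc k) (X ^ d + C m)) =
      algebraMap k[X] (RatFunc k) (∏ j ∈ J, p j) := by
    rw [map_prod]
    exact Finset.prod_congr rfl fun j _ => by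
      rw [← map_iterate_quad, iterate_quad_translate]
  have hsep : (∏ j ∈ J, p j).Separable := by
    refine separable_prod' (fun i _ j _ hij => ?_) fun j _ => ?_
    · have hu : (quad 0 m)^[i] m - (quad 0 m)^[j] m ≠ 0 := sub_ne_zero.2 fun h => hij (hinj h)
      refine ⟨C ((quad 0 m)^[i] m - (quad 0 m)^[j] m)⁻¹,
        -C ((quad 0 m)^[i] m - (quad 0 m)^[j] m)⁻¹, ?_⟩
      rw [neg_mul, ← sub_eq_add_neg, ← mul_sub, hp]
      simp only [add_sub_add_left_eq_sub]
      rw [← C_sub, ← C_mul, inv_mul_cancel₀ hu, C_1]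
    · have := separable_X_pow_sub_C (n := d) (-(quad 0 m)^[j] m) (by norm_cast; omega)
        (neg_ne_zero.2 (hne j))
      simpa [hp] using this
  have hmonic : ∀ j ∈ J, (p j).Monic := fun j _ => monic_X_pow_add_C _ (by omega)
  have hdeg : (∏ j ∈ J, p j).natDegree ≠ 0 := by
    rw [natDegree_prod_of_monic _ _ hmonic]
    simp only [hp, natDegree_X_pow_add_C, Finset.sum_const, smul_eq_mul]
    exact mul_ne_zero (Finset.card_ne_zero.2 hJ) (by omega)
  rw [hprod]
  rcases sq_eq_sq_iff_eq_or_eq_neg.1 (hε.trans (one_pow 2).symm) with rfl | rfl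
  · rw [one_mul]
    exact not_isSquare_algebraMap_of_squarefree hsep.squarefree hdeg
  · rw [neg_one_mul, ← map_neg]
    refine not_isSquare_algebraMap_of_squarefree ?_ (by rwa [natDegree_neg])
    exact hsep.squarefree.squarefree_of_dvd (neg_dvd.2 dvd_rfl)

theorem overRatFunc_family (d : ℕ) (m : k) :
    overRatFunc (family d m) = (X - C (algebraMap k[X] (RatFunc k) (X ^ d))) ^ 2 +
      C (algebraMap k[X] (RatFunc k) (X ^ d + C m)) := by
  simp [overRatFunc, family]

theorem arborealRep_family_bijective [CharZero k] (L : Type*) [Field L] [Algebra (RatFunc k) L]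
    [IsAlgClosure (RatFunc k) L] {d : ℕ} (hd : 1 ≤ d) {m : k}
    (h : (forwardOrbit (family d m) (X ^ d)).Infinite) :
    Function.Bijective (arborealRep L (overRatFunc (family d m))) := by
  have : CharZero (RatFunc k) :=
    charZero_of_injective_algebraMap (algebraMap k (RatFunc k)).injective
  have : IsGalois (RatFunc k) L := IsAlgClosure.isGalois (RatFunc k) L
  have : IsAlgClosed L := IsAlgClosure.isAlgClosed (RatFunc k)
  rw [overRatFunc_family]
  exact arborealRep_bijective (criticalIndep_family hd h)

end Family

/-! ### The critical orbit over `ℚ` -/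

theorem infinite_range_iterate_of_height {α β : Type*} [Preorder β] (f : α → α) (x : α) (H : α → β)
    (s : Set α) (hx : x ∈ s) (hs : ∀ y ∈ s, f y ∈ s ∧ H y < H (f y)) :
    (Set.range fun n : ℕ => f^[n] x).Infinite := by
  have hmem : ∀ n, f^[n] x ∈ s := fun n => by
    induction n with
    | zero => exact hx
    | succ n ih =>
      rw [Function.iterate_succ_apply']
      exact (hs _ ih).1
  have hmono : StrictMono fun n : ℕ => H (f^[n] x) := strictMono_nat_of_lt_succ fun n => by
    simp only [Function.iterate_succ_apply']
    exact (hs _ (hmem n)).2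
  exact Set.infinite_range_of_injective fun i j hij => hmono.injective (congrArg H hij)

/-- The critical orbit of `y ^ 2 + m` over `ℚ` is infinite unless `m` is `0`, `-1` or `-2`: it
escapes at a prime in the denominator of `m`, and for an integer `m` at the infinite place. -/
theorem infinite_orbit_rat {m : ℚ} (hm : m ∉ ({0, -1, -2} : Set ℚ)) :
    (Set.range fun n : ℕ => (quad 0 m)^[n] m).Infinite := by
  by_cases hden : m.den = 1
  · obtain ⟨a, rfl⟩ : ∃ a : ℤ, m = a := ⟨m.num, ((Rat.den_eq_one_iff m).1 hden).symm⟩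
    have ha : 1 ≤ a ∨ a ≤ -3 := by
      by_contra hcon
      have : a = 0 ∨ a = -1 ∨ a = -2 := by omega
      rcases this with rfl | rfl | rfl <;> simp at hm
    rcases ha with ha | ha
    · have ha' : (1 : ℚ) ≤ a := by exact_mod_cast ha
      refine infinite_range_iterate_of_height _ _ id {y | 1 ≤ y} ha' fun y (hy : 1 ≤ y) => ?_
      simp only [quad, Set.mem_ofPred_eq, id, sub_zero]
      constructor <;> nlinarith
    · have ha' : (a : ℚ) ≤ -3 := by exact_mod_cast ha
      refine infinite_range_iterate_of_height _ _ abs {y | -(a : ℚ) ≤ |y|}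
        (neg_le_abs (a : ℚ)) fun y (hy : -(a : ℚ) ≤ |y|) => ?_
      simp only [quad, Set.mem_ofPred_eq, sub_zero]
      have h1 : y ^ 2 + a ≤ |y ^ 2 + a| := le_abs_self _
      rw [← sq_abs y] at h1 ⊢
      constructor <;> nlinarith
  · obtain ⟨p, hp, hpd⟩ := Nat.exists_prime_and_dvd hden
    have : Fact p.Prime := ⟨hp⟩
    have hm1 : 1 < padicNorm p m := by
      have hnum : padicNorm p m.num = 1 := by
        rw [padicNorm.int_eq_one_iff, Int.natCast_dvd]
        exact fun h => hp.one_lt.ne' (Nat.dvd_one.1 (m.reduced ▸ Nat.dvd_gcd h hpd))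
      have hdlt : padicNorm p m.den < 1 := (padicNorm.nat_lt_one_iff _).2 hpd
      rw [← Rat.mul_den_eq_num, padicNorm.mul] at hnum
      have h0 := padicNorm.nonneg (p := p) m
      have h1 := padicNorm.nonneg (p := p) (m.den : ℚ)
      nlinarith
    refine infinite_range_iterate_of_height _ _ (padicNorm p) {y | padicNorm p m ≤ padicNorm p y}
      (le_refl (padicNorm p m)) fun y (hy : padicNorm p m ≤ padicNorm p y) => ?_
    have hlt : padicNorm p m < padicNorm p (y ^ 2) := by
      rw [pow_two, padicNorm.mul]
      nlinarith
    have hq : padicNorm p (quad 0 m y) = padicNorm p y * padicNorm p y := by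
      rw [quad, sub_zero, padicNorm.add_eq_max_of_ne hlt.ne', max_eq_left hlt.le, pow_two,
        padicNorm.mul]
    simp only [Set.mem_ofPred_eq, hq]
    constructor <;> nlinarith

end Arboreal

theorem proposition5 :
    (∀ (k : Type*) [Field k] [CharZero k]
      (L : Type*) [Field L] [Algebra (RatFunc k) L] [IsAlgClosure (RatFunc k) L]
      (d : ℕ) (_ : 1 ≤ d) (m : k),
      (Arboreal.forwardOrbit (Arboreal.family d m) (Polynomial.X ^ d)).Infinite →
        Function.Bijective
          (Arboreal.arborealRep L (Arboreal.overRatFunc (Arboreal.family d m)))) ∧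
    (∀ (L : Type*) [Field L] [Algebra (RatFunc ℚ) L] [IsAlgClosure (RatFunc ℚ) L]
      (d : ℕ) (_ : 1 ≤ d) (m : ℚ), m ∉ ({0, -1, -2} : Set ℚ) →
        Function.Bijective
          (Arboreal.arborealRep L (Arboreal.overRatFunc (Arboreal.family d m)))) := by
  refine ⟨fun k _ _ L _ _ _ d hd m h => Arboreal.arborealRep_family_bijective L hd h,
    fun L _ _ _ d hd m hm => Arboreal.arborealRep_family_bijective L hd ?_⟩
  rw [Arboreal.forwardOrbit_family]
  have hinj : Function.Injective fun y : ℚ => (X ^ d + C y : ℚ[X]) := fun y z h =>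
    C_injective (add_left_cancel h)
  have := (Arboreal.infinite_orbit_rat hm).image hinj.injOn
  rwa [← Set.range_comp] at this
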